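/- Let $E$ be a Fréchet space over $\mathbb{R}$ or $\mathbb{C}$ (a complete metrizable Hausdorff locally convex space) and let $E'_b$ be its strong dual, i.e. its dual $E'$ with the topology of uniform convergence on the bounded subsets of $E$. Assume that $E$ is quasinormable: for every equicontinuous set $A\subset E'$ there is a neighbourhood $V$ of $0$ in $E$ such that on $A$ the topology induced by $E'_b$ coincides with the topology of uniform convergence on $V$. Then $E'_b$ is complete, and it is a compactly regular $\mathcal{LB}$-space. That is: $E'_b$ is the locally convex inductive limit $\varinjlim_k G_k$ of an increasing sequence $G_1\hookrightarrow G_2\hookrightarrow\cdots$ of Banach spaces with continuous inclusions (so $E'=\bigcup_k G_k$ and $E'_b$ carries the finest locally convex topology for which all inclusions $G_k\hookrightarrow E'$ are continuous); and for every such representation $E'_b=\varinjlim_k G_k$, each compact subset $K$ of $E'_b$ is contained in some step $G_k$ and is compact in $G_k$. -/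

import Mathlib

open Topology

/-- A locally convex space `E` over `𝕜` (real or complex) is *quasinormable* if for every
equicontinuous subset `A` of the dual of `E` there is a neighbourhood `V` of `0` in `E` such that
on `A` the trace of the strong topology (Mathlib's topology on `E →L[𝕜] 𝕜`, uniform convergence on
the bounded subsets of `E`) is the topology of uniform convergence on `V`. -/
def IsQuasinormable (𝕜 E : Type*) [RCLike 𝕜] [AddCommGroup E] [Module 𝕜 E]
    [TopologicalSpace E] : Prop :=
  ∀ A : Set (E →L[𝕜] 𝕜), Equicontinuous (fun (f : A) (x : E) => f.1 x) →
    ∃ V ∈ 𝓝 (0 : E),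
      TopologicalSpace.induced (fun f : A => f.1) ContinuousLinearMap.topologicalSpace =
        TopologicalSpace.induced
          (fun f : A => UniformOnFun.ofFun ({V} : Set (Set E)) (fun x : E => f.1 x))
          (UniformOnFun.topologicalSpace E 𝕜 {V})

/-- `t` is a locally convex vector space topology on `X`. -/
structure IsLocallyConvexTopology (𝕜 : Type*) {X : Type*} [RCLike 𝕜] [AddCommGroup X]
    [Module 𝕜 X] [Module ℝ X] (t : TopologicalSpace X) : Prop where
  isTopologicalAddGroup : @IsTopologicalAddGroup X t _
  continuousSMul : @ContinuousSMul 𝕜 X _ _ t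
  locallyConvex : @LocallyConvexSpace ℝ X _ _ _ _ t

/-- The topological vector space `X` is the locally convex inductive limit of the increasing
sequence of Banach spaces `G k`, regarded as subspaces of `X` through the injections `ι k`. -/
structure IsLBLimit (𝕜 : Type*) {X : Type*} [RCLike 𝕜] [AddCommGroup X] [Module 𝕜 X] [Module ℝ X]
    [TopologicalSpace X] {G : ℕ → Type*} [∀ k, NormedAddCommGroup (G k)]
    [∀ k, NormedSpace 𝕜 (G k)] (ι : ∀ k, G k →ₗ[𝕜] X) : Prop where
  completeSpace : ∀ k, CompleteSpace (G k)
  injective : ∀ k, Function.Injective (ι k)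
  /-- `G k` is contained in `G (k + 1)`, with continuous inclusion. -/
  inclusion : ∀ k, ∃ j : G k →L[𝕜] G (k + 1), ∀ x, ι (k + 1) (j x) = ι k x
  exhausts : ∀ x : X, ∃ k, x ∈ Set.range (ι k)
  /-- The topology of `X` is the finest locally convex topology for which every `ι k` is
  continuous (in the order on topologies, `t ≤ t'` means that `t` is finer than `t'`). -/
  topology_isLeast :
    IsLeast {t : TopologicalSpace X | IsLocallyConvexTopology 𝕜 t ∧
      ∀ k, @Continuous (G k) X _ t (ι k)} (inferInstance : TopologicalSpace X)

/-- An *LB-space*: a Hausdorff locally convex inductive limit of an increasing sequence of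
Banach spaces. -/
def IsLBSpace.{u, v} (𝕜 : Type u) (X : Type v) [RCLike 𝕜] [AddCommGroup X] [Module 𝕜 X] [Module ℝ X]
    [TopologicalSpace X] : Prop :=
  T2Space X ∧ ∃ (G : ℕ → Type v) (_ : ∀ k, NormedAddCommGroup (G k))
    (_ : ∀ k, NormedSpace 𝕜 (G k)) (ι : ∀ k, G k →ₗ[𝕜] X), IsLBLimit 𝕜 ι

/-- The inductive limit `X` of the spaces `G k` is *compactly regular*: every compact subset of `X`
is contained in some step `G k` and is compact there. -/
def IsCompactlyRegular {𝕜 : Type*} {X : Type*} [RCLike 𝕜] [AddCommGroup X] [Module 𝕜 X]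
    [TopologicalSpace X] {G : ℕ → Type*} [∀ k, NormedAddCommGroup (G k)]
    [∀ k, NormedSpace 𝕜 (G k)] (ι : ∀ k, G k →ₗ[𝕜] X) : Prop :=
  ∀ K : Set X, IsCompact K → ∃ k, K ⊆ Set.range (ι k) ∧ IsCompact (ι k ⁻¹' K)

/-! Completeness: a limit that is uniform on bounded sets is uniform on convergent sequences, hence
continuous because `E` is first countable. Take increasing continuous seminorms `p n` that dominate
all others. The natural steps are the Banach spaces of functionals bounded by a multiple of `p n`.
For their limit topology to be the strong one, a seminorm `N` continuous on every step must be at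
most `1` on the polar of some bounded set. Choose weights so small that `N ≤ 1/2` on functionals
dominated by any partial sum `q n` of the weighted `p k`. Quasinormability gives a bounded set on
which smallness forces `N ≤ 1/2` for functionals dominated by `p n + q n`. Cut its scaled absolutely
convex hull with `{q n ≤ 1}`; Hahn-Banach then bounds `N` on the `p n`-dominated part of the polar
of this cut. The cuts have a bounded union, since `q n ≤ 1` controls `p k` for all `n > k`
(`IsQuasinormable.exists_isVonNBounded_seminorm_le_one`). A compact set is equicontinuous by
Banach-Steinhaus, and quasinormability makes it compact in a natural step. Grothendieck
factorization carries it into any other representation. -/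

open Filter Bornology Set

/-! ### Seminorms and Hahn-Banach splitting -/

section Seminorms

variable {𝕜 E : Type*} [RCLike 𝕜] [AddCommGroup E] [Module 𝕜 E]

/-- A seminorm `q` that is at most `ε` on the open unit ball of `p` is at most `ε * p`. -/
lemma Seminorm.le_mul_of_forall_lt_one {p q : Seminorm 𝕜 E} {ε : ℝ}
    (h : ∀ x, p x < 1 → q x ≤ ε) (x : E) : q x ≤ ε * p x := by
  have hε : 0 ≤ ε := by simpa using h 0 (by simp)
  have key : ∀ r : ℝ, p x < r → q x ≤ ε * r := by
    intro r hr
    have hr0 : 0 < r := (apply_nonneg p x).trans_lt hr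
    have hn : ‖((r⁻¹ : ℝ) : 𝕜)‖ = r⁻¹ := by
      rw [RCLike.norm_ofReal, abs_of_pos (inv_pos.2 hr0)]
    have := h (((r⁻¹ : ℝ) : 𝕜) • x) (by
      rw [map_smul_eq_mul, hn, inv_mul_lt_iff₀ hr0]; simpa using hr)
    rw [map_smul_eq_mul, hn, inv_mul_le_iff₀ hr0] at this
    linarith
  have hc : Tendsto (fun r : ℝ => ε * r) (𝓝[>] (p x)) (𝓝 (ε * p x)) :=
    ((continuous_const.mul continuous_id).tendsto _).mono_left nhdsWithin_le_nhds
  exact ge_of_tendsto hc (eventually_nhdsWithin_of_forall fun r hr => key r hr)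

/-- The `ℓ¹`-seminorm on finitely supported families. -/
noncomputable def finsuppL1Seminorm (𝕜 : Type*) [RCLike 𝕜] (B : Type*) : Seminorm 𝕜 (B →₀ 𝕜) :=
  Seminorm.of (fun c => c.sum fun _ a => ‖a‖)
    (fun c d => by
      classical
      have e : ∀ f : B →₀ 𝕜, f.support ⊆ c.support ∪ d.support →
          (f.sum fun _ a => ‖a‖) = ∑ b ∈ c.support ∪ d.support, ‖f b‖ := fun f hf =>
        Finsupp.sum_of_support_subset f hf _ (by simp)
      rw [e _ Finsupp.support_add, e c Finset.subset_union_left, e d Finset.subset_union_right,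
        ← Finset.sum_add_distrib]
      exact Finset.sum_le_sum fun b _ => norm_add_le _ _)
    (fun a c => by
      rw [Finsupp.sum_of_support_subset (a • c) Finsupp.support_smul _ (by simp), Finsupp.sum,
        Finset.mul_sum]
      exact Finset.sum_congr rfl fun b _ => by simp)

lemma finsuppL1Seminorm_apply {B : Type*} (c : B →₀ 𝕜) :
    finsuppL1Seminorm 𝕜 B c = c.sum fun _ a => ‖a‖ := rfl

lemma finsuppL1Seminorm_single {B : Type*} (b : B) :
    finsuppL1Seminorm 𝕜 B (Finsupp.single b 1) = 1 := by
  simp [finsuppL1Seminorm_apply]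

/-- Passes a bound on a set to its absolutely convex hull, whose points are the combinations of
`ℓ¹`-seminorm at most `1`. -/
lemma Seminorm.linearCombination_le {B : Type*} (p : Seminorm 𝕜 E) (v : B → E) {M : ℝ}
    (hM : ∀ b, p (v b) ≤ M) (c : B →₀ 𝕜) :
    p (Finsupp.linearCombination 𝕜 v c) ≤ finsuppL1Seminorm 𝕜 B c * M := by
  rw [Finsupp.linearCombination_apply, finsuppL1Seminorm_apply, Finsupp.sum, Finsupp.sum,
    Finset.sum_mul]
  refine (Finset.le_sum_of_subadditive p (map_zero p).le (map_add_le_add p) _ _).trans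
    (Finset.sum_le_sum fun b _ => ?_)
  rw [map_smul_eq_mul]
  exact mul_le_mul_of_nonneg_left (hM b) (norm_nonneg _)

/-- A Hahn-Banach decomposition: a functional dominated on the range of `T` by the sum of two
seminorms splits accordingly. -/
lemma exists_dual_le_and_sub_le {M : Type*} [AddCommGroup M] [Module 𝕜 M] (p : Seminorm 𝕜 E)
    (s : Seminorm 𝕜 M) (T : M →ₗ[𝕜] E) (f : E →ₗ[𝕜] 𝕜)
    (h : ∀ c, ‖f (T c)‖ ≤ p (T c) + s c) :
    ∃ g : E →ₗ[𝕜] 𝕜, (∀ x, ‖g x‖ ≤ p x) ∧ ∀ c, ‖f (T c) - g (T c)‖ ≤ s c := by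
  -- Extend from the graph of `T` to the product, dominated by `p + s`; the restriction to the first
  -- factor is `g`, and the error `f (T c) - g (T c)` is the value at `(0, c)`.
  let S : Submodule 𝕜 (E × M) := LinearMap.range (T.prod LinearMap.id)
  let F : Module.Dual 𝕜 S := (f ∘ₗ LinearMap.fst 𝕜 E M).domRestrict S
  let P : Seminorm 𝕜 (E × M) :=
    p.comp (LinearMap.fst 𝕜 E M) + s.comp (LinearMap.snd 𝕜 E M)
  have hF : ∀ x : S, ‖F x‖ ≤ P (x : E × M) := by
    rintro ⟨_, c, rfl⟩
    exact h c
  obtain ⟨G, hG, hGP⟩ := Module.Dual.exists_extension_of_le_seminorm S F hF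
  refine ⟨G ∘ₗ LinearMap.inl 𝕜 E M, fun x => ?_, fun c => ?_⟩
  · simpa [P] using hGP (x, 0)
  · have h1 : G (T c, c) = f (T c) := hG ⟨(T c, c), c, rfl⟩
    have h2 : f (T c) - (G ∘ₗ LinearMap.inl 𝕜 E M) (T c) = G (0, c) := by
      rw [← h1, LinearMap.comp_apply, LinearMap.inl_apply, ← map_sub]
      simp
    rw [h2]
    simpa [P] using hGP (0, c)

/-- A functional that is at most `1` where two seminorms are at most `1` is dominated by their
sum. -/
lemma norm_le_add_of_forall_le_one {M : Type*} [AddCommGroup M] [Module 𝕜 M]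
    (q s : Seminorm 𝕜 M) (f : M →ₗ[𝕜] 𝕜)
    (h : ∀ c, q c ≤ 1 → s c ≤ 1 → ‖f c‖ ≤ 1) (c : M) : ‖f c‖ ≤ q c + s c := by
  have := Seminorm.le_mul_of_forall_lt_one (p := q + s) (q := (normSeminorm 𝕜 𝕜).comp f) (ε := 1)
    (fun x hx => h x ?_ ?_) c
  · simpa using this
  · have := apply_nonneg s x
    rw [add_apply] at hx
    linarith
  · have := apply_nonneg q x
    rw [add_apply] at hx
    linarith

end Seminorms

/-! ### Continuous seminorms on locally convex spaces -/

section LocallyConvex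

open scoped ComplexOrder

variable {𝕜 X : Type*} [RCLike 𝕜] [AddCommGroup X] [Module 𝕜 X] [Module ℝ X]
  [IsScalarTower ℝ 𝕜 X] [TopologicalSpace X] [IsTopologicalAddGroup X] [ContinuousSMul 𝕜 X]
  [LocallyConvexSpace ℝ X]

/-- The nonnegative scalars of `𝕜` are exactly the nonnegative reals, so both notions of convexity
agree. -/
lemma locallyConvexSpace_of_real {𝕜 X : Type*} [RCLike 𝕜] [AddCommGroup X] [Module 𝕜 X]
    [Module ℝ X] [IsScalarTower ℝ 𝕜 X] [TopologicalSpace X] [LocallyConvexSpace ℝ X] :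
    LocallyConvexSpace 𝕜 X := by
  refine (locallyConvexSpace_iff_exists_convex_subset 𝕜 X).2 fun x U hU => ?_
  obtain ⟨S, hS, hc, hSU⟩ := (locallyConvexSpace_iff_exists_convex_subset ℝ X).1 ‹_› x U hU
  exact ⟨S, hS, convex_of_nonneg_surjective_algebraMap _
    (fun _ => RCLike.nonneg_iff_exists_ofReal.mp) hc, hSU⟩

variable (𝕜) in
lemma exists_continuous_seminorm_subset {U : Set X} (hU : U ∈ 𝓝 0) :
    ∃ N : Seminorm 𝕜 X, Continuous N ∧ ∀ x, N x ≤ 1 → x ∈ U := by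
  have : ContinuousSMul ℝ X := IsScalarTower.continuousSMul 𝕜
  have : LocallyConvexSpace 𝕜 X := locallyConvexSpace_of_real
  obtain ⟨S, hS, hSU⟩ := (nhds_hasBasis_absConvex_open 𝕜 X).mem_iff.1 hU
  let s : AbsConvexOpenSets 𝕜 X := ⟨S, hS⟩
  have hc := with_gaugeSeminormFamily.continuous_seminorm s
  -- Doubling the gauge puts its closed unit ball inside the open set `S`.
  refine ⟨(2 : NNReal) • gaugeSeminormFamily 𝕜 X s, hc.const_smul (2 : NNReal),
    fun x hx => hSU ?_⟩
  have h2 : 2 * gaugeSeminormFamily 𝕜 X s x ≤ 1 := hx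
  change x ∈ (s : Set X)
  rw [← gaugeSeminormFamily_ball s, Seminorm.mem_ball_zero]
  linarith

lemma isVonNBounded_iff_forall_continuous_seminorm {B : Set X} :
    IsVonNBounded 𝕜 B ↔ ∀ q : Seminorm 𝕜 X, Continuous q → ∃ M, ∀ x ∈ B, q x ≤ M := by
  have : ContinuousSMul ℝ X := IsScalarTower.continuousSMul 𝕜
  have : LocallyConvexSpace 𝕜 X := locallyConvexSpace_of_real
  rw [(PolynormableSpace.withSeminorms 𝕜 X).isVonNBounded_iff_seminorm_bounded]
  refine ⟨fun h q hq => ?_, fun h q => ?_⟩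
  · obtain ⟨r, -, hr⟩ := h ⟨q, hq⟩
    exact ⟨r, fun x hx => (hr x hx).le⟩
  · obtain ⟨M, hM⟩ := h q.1 q.2
    exact ⟨max M 0 + 1, by positivity, fun x hx =>
      ((hM x hx).trans (le_max_left _ _)).trans_lt (lt_add_one _)⟩

variable (𝕜 X) in
/-- In a first countable locally convex space, there is an increasing sequence of continuous
seminorms that dominates every continuous seminorm. -/
lemma exists_cofinal_seminorm_seq [FirstCountableTopology X] :
    ∃ p : ℕ → Seminorm 𝕜 X, (∀ n, Continuous (p n)) ∧ Monotone p ∧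
      ∀ q : Seminorm 𝕜 X, Continuous q → ∃ n, q ≤ p n := by
  obtain ⟨U, hU⟩ := (𝓝 (0 : X)).exists_antitone_basis
  choose N hNc hN using fun n => exists_continuous_seminorm_subset 𝕜 (hU.mem n)
  have hs : ∀ n x, (∑ i ∈ Finset.range (n + 1), N i) x = ∑ i ∈ Finset.range (n + 1), N i x := by
    intro n x
    rw [← FunLike.coeAddMonoidHom_apply, map_sum, Finset.sum_apply]
    rfl
  refine ⟨fun n => ∑ i ∈ Finset.range (n + 1), N i, fun n => ?_, monotone_nat_of_le_succ
    fun n x => ?_, fun q hq => ?_⟩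
  · have : ((∑ i ∈ Finset.range (n + 1), N i : Seminorm 𝕜 X) : X → ℝ) =
        fun x => ∑ i ∈ Finset.range (n + 1), N i x := funext (hs n)
    rw [this]
    fun_prop
  · rw [hs, hs, Finset.sum_range_succ _ (n + 1)]
    exact le_add_of_nonneg_right (apply_nonneg _ _)
  · have : {x | q x < 1} ∈ 𝓝 (0 : X) :=
      (isOpen_lt hq continuous_const).mem_nhds (by simp)
    obtain ⟨n, hn⟩ := hU.mem_iff.1 this
    refine ⟨n, fun x => ?_⟩
    have := Seminorm.le_mul_of_forall_lt_one (p := ∑ i ∈ Finset.range (n + 1), N i) (q := q)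
      (ε := 1) (fun y hy => (hn (hN n y ?_)).le) x
    · simpa using this
    · rw [hs] at hy
      exact (Finset.single_le_sum (f := fun i => N i y) (fun i _ => apply_nonneg _ _)
        (Finset.self_mem_range_succ n)).trans hy.le

end LocallyConvex

/-! ### Bounded sets and polars in the strong dual -/

lemma continuous_of_norm_le_seminorm {𝕜 E : Type*} [RCLike 𝕜] [AddCommGroup E] [Module 𝕜 E]
    [TopologicalSpace E] [IsTopologicalAddGroup E] {p : Seminorm 𝕜 E} (hp : Continuous p)
    {g : E →ₗ[𝕜] 𝕜} (h : ∀ x, ‖g x‖ ≤ p x) : Continuous g := by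
  refine continuous_of_continuousAt_zero g ?_
  rw [ContinuousAt, map_zero]
  exact squeeze_zero_norm h (by simpa using hp.tendsto 0)

/-- The neighbourhoods of zero in the strong dual, in terms of bounded sets. -/
lemma StrongDual.exists_isVonNBounded_subset {𝕜 E : Type*} [RCLike 𝕜] [AddCommGroup E]
    [Module 𝕜 E] [TopologicalSpace E] {S : Set (E →L[𝕜] 𝕜)} (hS : S ∈ 𝓝 0) :
    ∃ B : Set E, IsVonNBounded 𝕜 B ∧ ∃ δ > 0, ∀ f : E →L[𝕜] 𝕜, (∀ x ∈ B, ‖f x‖ ≤ δ) → f ∈ S := by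
  obtain ⟨⟨B, δ⟩, ⟨hB, hδ⟩, h⟩ := (ContinuousLinearMap.hasBasis_nhds_zero_of_basis
    (Metric.nhds_basis_closedBall (x := (0 : 𝕜)))).mem_iff.1 hS
  exact ⟨B, hB, δ, hδ, fun f hf => h fun x hx => by simpa using hf x hx⟩

/-- A functional dominated by a sum splits. -/
lemma StrongDual.exists_add_eq {𝕜 E : Type*} [RCLike 𝕜] [AddCommGroup E] [Module 𝕜 E]
    [TopologicalSpace E] [IsTopologicalAddGroup E] {p q : Seminorm 𝕜 E} (hp : Continuous p) (f : E →L[𝕜] 𝕜)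
    (h : ∀ x, ‖f x‖ ≤ p x + q x) :
    ∃ g h : E →L[𝕜] 𝕜, g + h = f ∧ (∀ x, ‖g x‖ ≤ p x) ∧ ∀ x, ‖h x‖ ≤ q x := by
  obtain ⟨g, hg, hgq⟩ := exists_dual_le_and_sub_le p q LinearMap.id f.toLinearMap h
  let G : E →L[𝕜] 𝕜 := ⟨g, continuous_of_norm_le_seminorm hp hg⟩
  exact ⟨G, f - G, add_sub_cancel _ _, hg, hgq⟩

section StrongDual

variable {𝕜 E : Type*} [RCLike 𝕜] [AddCommGroup E] [Module 𝕜 E] [Module ℝ E]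
  [IsScalarTower ℝ 𝕜 E] [UniformSpace E] [IsUniformAddGroup E] [ContinuousSMul 𝕜 E]
  [LocallyConvexSpace ℝ E]

/-- The seminorm `x ↦ ‖f x‖` of a functional `f`. -/
noncomputable def dualSeminorm (f : E →ₗ[𝕜] 𝕜) : Seminorm 𝕜 E := (normSeminorm 𝕜 𝕜).comp f

/-- Quasinormability in terms of a cofinal sequence of seminorms: on each polar, the strong
topology is finer than that of the norm of some later polar. -/
lemma IsQuasinormable.exists_eventually_sub_le (hE : IsQuasinormable 𝕜 E)
    {p : ℕ → Seminorm 𝕜 E} (hp : ∀ n, Continuous (p n)) (hmono : Monotone p)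
    (hcof : ∀ q : Seminorm 𝕜 E, Continuous q → ∃ n, q ≤ p n) (n : ℕ) :
    ∃ m, n ≤ m ∧ ∀ f₀ : E →L[𝕜] 𝕜, (∀ x, ‖f₀ x‖ ≤ p n x) → ∀ ε > 0, ∀ᶠ f in 𝓝 f₀,
      (∀ x, ‖f x‖ ≤ p n x) → ∀ x, ‖(f - f₀) x‖ ≤ ε * p m x := by
  let A : Set (E →L[𝕜] 𝕜) := {f | ∀ x, ‖f x‖ ≤ p n x}
  have hA : Equicontinuous (fun (f : A) (x : E) => f.1 x) :=
    (((norm_withSeminorms 𝕜 𝕜).equicontinuous_TFAE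
      (fun f : A => (f.1 : E →ₗ[𝕜] 𝕜))).out 3 1).1 fun _ =>
        (⟨p n, hp n, fun f x => f.2 x⟩ : ∃ q : Seminorm 𝕜 E, Continuous q ∧ ∀ f : A, _ ≤ q)
  obtain ⟨V, hV, htop⟩ := hE A hA
  obtain ⟨N, hN, hNV⟩ := exists_continuous_seminorm_subset 𝕜 hV
  obtain ⟨k, hk⟩ := hcof N hN
  refine ⟨max n k, le_max_left _ _, fun f₀ hf₀ ε hε => ?_⟩
  have hgen : {f : A | ∀ x ∈ V, dist (f₀ x) (f.1 x) < ε} ∈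
      @nhds A (TopologicalSpace.induced
          (fun f : A => UniformOnFun.ofFun ({V} : Set (Set E)) (fun x : E => f.1 x))
          (UniformOnFun.topologicalSpace E 𝕜 {V})) ⟨f₀, hf₀⟩ := by
    rw [nhds_induced]
    exact ⟨_, UniformOnFun.gen_mem_nhds _ _ _ (mem_singleton V) (Metric.dist_mem_uniformity hε),
      fun f hf x hx => hf x hx⟩
  rw [← htop, nhds_induced] at hgen
  obtain ⟨S, hS, hSsub⟩ := hgen
  filter_upwards [hS] with f hfS hf x
  refine Seminorm.le_mul_of_forall_lt_one (p := p (max n k)) (q := dualSeminorm (f - f₀).toLinearMap)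
    (fun y hy => ?_) x
  have hyV : y ∈ V := hNV y ((hk y).trans ((hmono (le_max_right n k) y).trans hy.le))
  have := hSsub (show (⟨f, hf⟩ : A) ∈ _ from hfS) y hyV
  rw [dist_eq_norm, norm_sub_rev] at this
  exact this.le

/-- If a seminorm `N` on the dual is small on the functionals dominated by `p` and on the
`r`-dominated functionals that are small on a bounded set `B`, then it is small on the functionals
that are small on a bounded subset of the unit ball of `p`. -/
lemma exists_isVonNBounded_forall_le_one {p r : Seminorm 𝕜 E} (hp : Continuous p)
    (N : Seminorm 𝕜 (E →L[𝕜] 𝕜)) (hN : ∀ f : E →L[𝕜] 𝕜, (∀ x, ‖f x‖ ≤ p x) → N f ≤ 1 / 2)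
    {B : Set E} (hB : IsVonNBounded 𝕜 B) {δ : ℝ} (hδ : 0 < δ)
    (hBN : ∀ f : E →L[𝕜] 𝕜, (∀ x ∈ B, ‖f x‖ ≤ δ) → (∀ x, ‖f x‖ ≤ r x + p x) → N f ≤ 1 / 2) :
    ∃ D : Set E, IsVonNBounded 𝕜 D ∧ (∀ x ∈ D, p x ≤ 1) ∧
      ∀ f : E →L[𝕜] 𝕜, (∀ x ∈ D, ‖f x‖ ≤ 1) → (∀ x, ‖f x‖ ≤ r x) → N f ≤ 1 := by
  let T : (B →₀ 𝕜) →ₗ[𝕜] E := Finsupp.linearCombination 𝕜 ((↑) : B → E)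
  let s : Seminorm 𝕜 (B →₀ 𝕜) := δ.toNNReal • finsuppL1Seminorm 𝕜 B
  have hs : ∀ c, s c = δ * finsuppL1Seminorm 𝕜 B c := fun c => by
    change (δ.toNNReal : ℝ) * _ = _
    rw [Real.coe_toNNReal δ hδ.le]
  -- This is `δ⁻¹` times the absolutely convex hull of `B`, cut with the unit ball of `p`.
  refine ⟨{x | ∃ c, T c = x ∧ p x ≤ 1 ∧ s c ≤ 1}, ?_, ?_, ?_⟩
  · rw [isVonNBounded_iff_forall_continuous_seminorm] at hB ⊢
    intro q hq
    obtain ⟨M, hM⟩ := hB q hq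
    refine ⟨δ⁻¹ * max M 0, ?_⟩
    rintro x ⟨c, rfl, -, hc⟩
    refine (q.linearCombination_le ((↑) : B → E) (M := max M 0)
      (fun b => (hM b b.2).trans (le_max_left _ _)) c).trans ?_
    gcongr
    rwa [hs, ← le_inv_mul_iff₀ hδ, mul_one] at hc
  · rintro x ⟨c, rfl, hc, -⟩
    exact hc
  · intro f hfD hfr
    obtain ⟨g, hgp, hgs⟩ := exists_dual_le_and_sub_le p s T f (fun c =>
      norm_le_add_of_forall_le_one (p.comp T) s (f.toLinearMap ∘ₗ T)
        (fun d hd hsd => hfD _ ⟨d, rfl, hd, hsd⟩) c)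
    let G : E →L[𝕜] 𝕜 := ⟨g, continuous_of_norm_le_seminorm hp hgp⟩
    have h1 : N G ≤ 1 / 2 := hN G hgp
    have h2 : N (f - G) ≤ 1 / 2 := by
      refine hBN _ (fun x hx => ?_) fun x => ?_
      · have := hgs (Finsupp.single ⟨x, hx⟩ 1)
        rw [hs, finsuppL1Seminorm_single] at this
        simpa [T, G] using! this
      · exact (norm_sub_le _ _).trans (add_le_add (hfr x) (hgp x))
    calc N f = N (G + (f - G)) := by rw [add_sub_cancel]
      _ ≤ N G + N (f - G) := map_add_le_add _ _ _
      _ ≤ 1 := by linarith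

/-- In a quasinormable metrizable space, a seminorm on the dual that is bounded on equicontinuous
sets is bounded on the polar of some bounded set. -/
lemma IsQuasinormable.exists_isVonNBounded_seminorm_le_one (hE : IsQuasinormable 𝕜 E)
    {p : ℕ → Seminorm 𝕜 E} (hp : ∀ n, Continuous (p n)) (hmono : Monotone p)
    (hcof : ∀ q : Seminorm 𝕜 E, Continuous q → ∃ n, q ≤ p n)
    (N : Seminorm 𝕜 (E →L[𝕜] 𝕜)) {c : ℕ → NNReal} (hc : ∀ k, 0 < c k)
    (hN : ∀ k (a : NNReal) (f : E →L[𝕜] 𝕜), (∀ x, ‖f x‖ ≤ a * p k x) → N f ≤ a * c k) :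
    ∃ D : Set E, IsVonNBounded 𝕜 D ∧
      ∀ f : E →L[𝕜] 𝕜, (∀ x ∈ D, ‖f x‖ ≤ 1) → N f ≤ 1 := by
  -- The `k`-th piece of a functional dominated by `q n` contributes at most `2 ^ (-(k + 2))` to
  -- `N`, so the total stays below `1/2`.
  let μ : ℕ → NNReal := fun k => (1 / 2) ^ (k + 2) / c k
  have hμ : ∀ k, 0 < μ k := fun k => by have := hc k; positivity
  let q : ℕ → Seminorm 𝕜 E := fun n => ∑ k ∈ Finset.range n, μ k • p k
  have hq_succ : ∀ n, q (n + 1) = q n + μ n • p n := fun n => Finset.sum_range_succ _ n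
  have hq_cont : ∀ n, Continuous (q n) := by
    intro n
    induction n with
    | zero => exact continuous_const
    | succ n ih => rw [hq_succ]; exact ih.add ((hp n).const_smul (μ n))
  have hq_mono : Monotone q := monotone_nat_of_le_succ fun n x => by
    rw [hq_succ]
    exact le_add_of_nonneg_right (apply_nonneg _ _)
  have hNq : ∀ n (f : E →L[𝕜] 𝕜), (∀ x, ‖f x‖ ≤ q n x) → N f ≤ (1 - (1 / 2) ^ n) / 2 := by
    intro n
    induction n with
    | zero =>
      intro f hf
      have : f = 0 := by
        ext x
        simpa [q] using hf x
      simp [this]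
    | succ n ih =>
      intro f hf
      obtain ⟨g, h, rfl, hg, hh⟩ := StrongDual.exists_add_eq (hq_cont n) f
        (q := μ n • p n) (fun x => by simpa only [hq_succ] using! hf x)
      have h1 := ih g hg
      have h2 := hN n (μ n) h hh
      have h3 : (μ n : ℝ) * c n = (1 / 2) ^ (n + 2) := by
        have : (c n : ℝ) ≠ 0 := by exact_mod_cast (hc n).ne'
        simp [μ, this]
      have := map_add_le_add N g h
      rw [h3] at h2
      rw [pow_succ] at h2 ⊢
      rw [pow_succ] at h2
      linarith
  have hstep : ∀ n, ∃ D : Set E, IsVonNBounded 𝕜 D ∧ (∀ x ∈ D, q n x ≤ 1) ∧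
      ∀ f : E →L[𝕜] 𝕜, (∀ x ∈ D, ‖f x‖ ≤ 1) → (∀ x, ‖f x‖ ≤ p n x) → N f ≤ 1 := by
    intro n
    -- The remainder after splitting off a `q n`-dominated part is dominated only by `p n + q n`, so
    -- quasinormability is applied at a later index.
    obtain ⟨n', hn'⟩ := hcof (p n + q n) ((hp n).add (hq_cont n))
    obtain ⟨m, -, hm⟩ := hE.exists_eventually_sub_le hp hmono hcof n'
    have hε : (0 : ℝ) < ((1 / 2 / c m : NNReal) : ℝ) := by
      have := hc m
      positivity
    obtain ⟨B, hB, δ, hδ, hBδ⟩ := StrongDual.exists_isVonNBounded_subset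
      (hm 0 (fun x => by simp) _ hε)
    refine exists_isVonNBounded_forall_le_one (hq_cont n) N (fun f hf => ?_) hB hδ
      fun f hfB hf => ?_
    · refine (hNq n f hf).trans ?_
      have : (0 : ℝ) ≤ (1 / 2) ^ n := by positivity
      linarith
    · have h1 : ∀ x, ‖f x‖ ≤ ((1 / 2 / c m : NNReal) : ℝ) * p m x := by
        simpa using hBδ f hfB fun x => (hf x).trans (hn' x)
      refine (hN m _ f h1).trans_eq ?_
      have : (c m : ℝ) ≠ 0 := by exact_mod_cast (hc m).ne'
      push_cast
      field_simp
  choose D hD hDq hDN using hstep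
  refine ⟨⋃ n, D n, ?_, fun f hf => ?_⟩
  · rw [isVonNBounded_iff_forall_continuous_seminorm]
    intro r hr
    obtain ⟨k, hk⟩ := hcof r hr
    choose M hM using fun n => isVonNBounded_iff_forall_continuous_seminorm.1 (hD n) (p k) (hp k)
    -- The sum covers the finitely many `D n` with `n ≤ k`; for `n > k`, `q (k + 1) ≤ q n ≤ 1` on `D
    -- n` gives `p k ≤ (μ k)⁻¹`.
    refine ⟨∑ n ∈ Finset.range (k + 1), |M n| + (μ k : ℝ)⁻¹, fun x hx => (hk x).trans ?_⟩
    obtain ⟨n, hx⟩ := mem_iUnion.1 hx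
    have hpos : (0 : ℝ) < (μ k : ℝ)⁻¹ := inv_pos.2 (by exact_mod_cast hμ k)
    rcases le_or_gt n k with hnk | hnk
    · have h1 := Finset.single_le_sum (f := fun n => |M n|) (fun i _ => abs_nonneg _)
        (Finset.mem_range.2 (Nat.lt_succ_of_le hnk))
      have h2 := (hM n x hx).trans (le_abs_self _)
      linarith
    · have h1 : 0 ≤ ∑ n ∈ Finset.range (k + 1), |M n| := Finset.sum_nonneg fun i _ => abs_nonneg _
      have h2 : (μ k : ℝ) * p k x ≤ 1 := by
        have h3 := (hq_mono (Nat.succ_le_of_lt hnk) x).trans (hDq n x hx)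
        rw [Nat.succ_eq_add_one, hq_succ] at h3
        have h4 : q k x + (μ k : ℝ) * p k x ≤ 1 := h3
        have := apply_nonneg (q k) x
        linarith
      have h5 : p k x ≤ (μ k : ℝ)⁻¹ := by
        rwa [← le_inv_mul_iff₀ (by exact_mod_cast hμ k), mul_one] at h2
      linarith
  · obtain ⟨n, hn⟩ := hcof (dualSeminorm f.toLinearMap) (continuous_norm.comp f.continuous)
    exact hDN n f (fun x hx => hf x (mem_iUnion.2 ⟨n, hx⟩)) hn

end StrongDual

/-! ### Open mapping and Grothendieck factorization -/

section Factorization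

variable {𝕜 F H : Type*} [RCLike 𝕜] [NormedAddCommGroup F] [NormedSpace 𝕜 F]
  [NormedAddCommGroup H] [NormedSpace 𝕜 H]

/-- The iteration step in the open mapping theorem. -/
lemma ContinuousLinearMap.surjective_of_exists_approx_preimage [CompleteSpace H] (f : H →L[𝕜] F)
    {C : ℝ} (hC : ∀ y, ∃ x, ‖y - f x‖ ≤ 1 / 2 * ‖y‖ ∧ ‖x‖ ≤ C * ‖y‖) :
    Function.Surjective f := by
  choose g hg hgC using hC
  intro y
  let h : F → F := fun y => y - f (g y)
  have hnle : ∀ n : ℕ, ‖h^[n] y‖ ≤ (1 / 2) ^ n * ‖y‖ := by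
    intro n
    induction n with
    | zero => simp
    | succ n ih =>
      rw [Function.iterate_succ_apply', pow_succ', mul_assoc]
      exact (hg _).trans (by gcongr)
  have hC0 : 0 ≤ |C| := abs_nonneg C
  have ule : ∀ n, ‖g (h^[n] y)‖ ≤ (1 / 2) ^ n * (|C| * ‖y‖) := fun n =>
    calc ‖g (h^[n] y)‖ ≤ C * ‖h^[n] y‖ := hgC _
      _ ≤ |C| * ((1 / 2) ^ n * ‖y‖) := by
        gcongr
        · exact le_abs_self C
        · exact hnle n
      _ = (1 / 2) ^ n * (|C| * ‖y‖) := by ring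
  have su : Summable fun n => g (h^[n] y) := Summable.of_norm_bounded
    (summable_geometric_two.mul_right _) ule
  have hsum : ∀ n : ℕ, f (∑ i ∈ Finset.range n, g (h^[i] y)) = y - h^[n] y := by
    intro n
    induction n with
    | zero => simp
    | succ n ih =>
      rw [Finset.sum_range_succ, map_add, ih, Function.iterate_succ_apply']
      simp only [h]
      abel
  refine ⟨∑' n, g (h^[n] y), ?_⟩
  have L₁ := (f.continuous.tendsto _).comp su.hasSum.tendsto_sum_nat
  have L₂ : Tendsto (fun n => h^[n] y) atTop (𝓝 0) := by
    refine squeeze_zero_norm hnle ?_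
    simpa using (tendsto_pow_atTop_nhds_zero_of_lt_one (r := (1 / 2 : ℝ)) (by norm_num)
      (by norm_num)).mul_const ‖y‖
  have L₃ := (tendsto_const_nhds (x := y)).sub L₂
  rw [sub_zero] at L₃
  exact tendsto_nhds_unique L₁ (L₃.congr fun n => (hsum n).symm)

/-- A continuous linear map between Banach spaces is surjective if the closure of the image of some
ball has an interior point. -/
lemma ContinuousLinearMap.surjective_of_interior_closure_nonempty [CompleteSpace H] (f : H →L[𝕜] F)
    {r : ℝ} (h : (interior (closure (f '' Metric.ball 0 r))).Nonempty) :
    Function.Surjective f := by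
  obtain ⟨a, ha⟩ := h
  obtain ⟨ε, hε, hball⟩ := Metric.mem_nhds_iff.1 (mem_interior_iff_mem_nhds.1 ha)
  have hr : 0 < r := by
    by_contra! hr
    have := hball (Metric.mem_ball_self hε)
    simp [Metric.ball_eq_empty.2 hr] at this
  -- Write `y` as half the difference of `a + y` and `a - y`: the centre `a` cancels.
  have approx : ∀ y : F, ‖y‖ < ε → ∀ η > 0, ∃ x : H, ‖x‖ ≤ r ∧ ‖y - f x‖ ≤ η := by
    intro y hy η hη
    obtain ⟨_, ⟨x₁, hx₁, rfl⟩, h₁⟩ := Metric.mem_closure_iff.1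
      (hball (show a + y ∈ Metric.ball a ε by simpa using hy)) η hη
    obtain ⟨_, ⟨x₂, hx₂, rfl⟩, h₂⟩ := Metric.mem_closure_iff.1
      (hball (show a - y ∈ Metric.ball a ε by simpa [dist_eq_norm] using hy)) η hη
    rw [dist_eq_norm] at h₁ h₂
    rw [mem_ball_zero_iff] at hx₁ hx₂
    have hn : ‖((1 / 2 : ℝ) : 𝕜)‖ = 1 / 2 := by
      rw [RCLike.norm_ofReal, abs_of_pos (by norm_num)]
    have h2 : ((1 / 2 : ℝ) : 𝕜) * 2 = 1 := by push_cast; norm_num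
    refine ⟨((1 / 2 : ℝ) : 𝕜) • (x₁ - x₂), ?_, ?_⟩
    · rw [norm_smul, hn]
      have := norm_sub_le x₁ x₂
      linarith
    · have e : y - f (((1 / 2 : ℝ) : 𝕜) • (x₁ - x₂)) =
          ((1 / 2 : ℝ) : 𝕜) • ((a + y - f x₁) - (a - y - f x₂)) := by
        have : y = ((1 / 2 : ℝ) : 𝕜) • (y + y) := by
          rw [← two_smul 𝕜 y, smul_smul, h2, one_smul]
        nth_rewrite 1 [this]
        rw [map_smul, ← smul_sub, map_sub]
        congr 1
        abel
      rw [e, norm_smul, hn]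
      have := norm_sub_le (a + y - f x₁) (a - y - f x₂)
      linarith
  refine f.surjective_of_exists_approx_preimage (C := 2 * r / ε) fun y => ?_
  rcases eq_or_ne y 0 with rfl | hy
  · exact ⟨0, by simp⟩
  have hy0 : 0 < ‖y‖ := norm_pos_iff.2 hy
  -- Rescales `y` to norm `ε / 2`, so the tolerance `ε / 4` is a relative error of `1 / 2`.
  let t : ℝ := ε / (2 * ‖y‖)
  have ht : 0 < t := by positivity
  have hnt : ‖(t : 𝕜)‖ = t := by rw [RCLike.norm_ofReal, abs_of_pos ht]
  have ht0 : (t : 𝕜) ≠ 0 := by exact_mod_cast ht.ne'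
  have hty : t * ‖y‖ = ε / 2 := by simp only [t]; field_simp
  obtain ⟨x, hx, hxy⟩ := approx ((t : 𝕜) • y) (by rw [norm_smul, hnt, hty]; linarith) (ε / 4)
    (by positivity)
  refine ⟨(t : 𝕜)⁻¹ • x, ?_, ?_⟩
  · have e : y - f ((t : 𝕜)⁻¹ • x) = (t : 𝕜)⁻¹ • ((t : 𝕜) • y - f x) := by
      rw [smul_sub, smul_smul, inv_mul_cancel₀ ht0, one_smul, map_smul]
    rw [e, norm_smul, norm_inv, hnt, inv_mul_le_iff₀ ht]
    linarith
  · rw [norm_smul, norm_inv, hnt, inv_mul_le_iff₀ ht]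
    calc ‖x‖ ≤ r := hx
      _ = 2 * r / ε * (ε / 2) := by field_simp
      _ = t * (2 * r / ε * ‖y‖) := by rw [← hty]; ring

/-- **Grothendieck's factorization theorem**: if the range of a continuous linear map `u` from a
Banach space to a Hausdorff space is covered by countably many Banach spaces that are continuously
embedded, then `u` factors through one of them. -/
lemma ContinuousLinearMap.exists_factorization {X : Type*} [CompleteSpace F] [AddCommGroup X]
    [Module 𝕜 X] [TopologicalSpace X] [T2Space X] {G : ℕ → Type*} [∀ k, NormedAddCommGroup (G k)]
    [∀ k, NormedSpace 𝕜 (G k)] [∀ k, CompleteSpace (G k)] (u : F →L[𝕜] X)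
    (ι : ∀ k, G k →L[𝕜] X) (hι : ∀ k, Function.Injective (ι k))
    (hcov : ∀ y, ∃ k, u y ∈ range (ι k)) :
    ∃ k, ∃ v : F →L[𝕜] G k, ∀ y, ι k (v y) = u y := by
  -- The fibre product of `u` and `ι k`, closed as `X` is Hausdorff. By Baire one projection to `F`
  -- is onto; it is injective because `ι k` is, and its inverse gives `v`.
  let S : ∀ k, Submodule 𝕜 (F × G k) := fun k =>
    LinearMap.eqLocus (u.comp (ContinuousLinearMap.fst 𝕜 F (G k))).toLinearMap
      ((ι k).comp (ContinuousLinearMap.snd 𝕜 F (G k))).toLinearMap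
  have hS : ∀ k, IsClosed (S k : Set (F × G k)) := fun k =>
    isClosed_eq (u.continuous.comp continuous_fst) ((ι k).continuous.comp continuous_snd)
  have : ∀ k, CompleteSpace (S k) := fun k => (hS k).completeSpace_coe
  let T : ∀ k, S k →L[𝕜] F := fun k => (ContinuousLinearMap.fst 𝕜 F (G k)).comp (S k).subtypeL
  obtain ⟨⟨k, n⟩, hkn⟩ := nonempty_interior_of_iUnion_of_closed
    (f := fun i : ℕ × ℕ => closure (T i.1 '' Metric.ball 0 i.2)) (fun _ => isClosed_closure) (by
      refine eq_univ_of_forall fun y => ?_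
      obtain ⟨k, z, hz⟩ := hcov y
      let w : S k := ⟨(y, z), hz.symm⟩
      obtain ⟨n, hn⟩ := exists_nat_gt ‖w‖
      exact mem_iUnion.2 ⟨(k, n), subset_closure ⟨w, by simpa using hn, rfl⟩⟩)
  have hsurj := (T k).surjective_of_interior_closure_nonempty hkn
  have hinj : LinearMap.ker (T k).toLinearMap = ⊥ := by
    refine LinearMap.ker_eq_bot'.2 ?_
    rintro ⟨⟨y, z⟩, hyz⟩ (rfl : y = 0)
    have hz : ι k z = 0 := by
      have : u 0 = ι k z := hyz
      rw [← this, map_zero]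
    have : z = 0 := hι k (by rw [hz, map_zero])
    subst this
    rfl
  let e : S k ≃L[𝕜] F := ContinuousLinearEquiv.ofBijective (T k) hinj (LinearMap.range_eq_top.2 hsurj)
  refine ⟨k, ((ContinuousLinearMap.snd 𝕜 F (G k)).comp (S k).subtypeL).comp
    (e.symm : F →L[𝕜] S k), fun y => ?_⟩
  have h1 : u ((e.symm y : S k) : F × G k).1 = ι k ((e.symm y : S k) : F × G k).2 := (e.symm y).2
  have h2 : ((e.symm y : S k) : F × G k).1 = y := e.apply_symm_apply y
  rw [h2] at h1
  exact h1.symm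

end Factorization

/-! ### Natural Banach steps of the dual -/

/-- A group topology is finer than a locally convex one if the unit balls of the continuous
seminorms of the latter are neighbourhoods of zero for the former. -/
lemma IsLocallyConvexTopology.le_of_forall_seminorm {𝕜 X : Type*} [RCLike 𝕜] [AddCommGroup X]
    [Module 𝕜 X] [Module ℝ X] [IsScalarTower ℝ 𝕜 X] {s t : TopologicalSpace X}
    (hs : @IsTopologicalAddGroup X s _) (ht : IsLocallyConvexTopology 𝕜 t)
    (h : ∀ N : Seminorm 𝕜 X, @Continuous X ℝ t _ N → {x | N x ≤ 1} ∈ @nhds X s 0) : s ≤ t := by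
  rw [← continuous_id_iff_le]
  refine @continuous_of_continuousAt_zero X s _ hs X (X →+ X) _ t
    ht.isTopologicalAddGroup.toContinuousAdd _ _ (AddMonoidHom.id X) fun U hU => ?_
  obtain ⟨N, hN, hNU⟩ := @exists_continuous_seminorm_subset 𝕜 X _ _ _ _ _ t
    ht.isTopologicalAddGroup ht.continuousSMul ht.locallyConvex U hU
  exact mem_of_superset (h N hN) hNU

section SeminormedBy

variable {𝕜 E : Type*} [RCLike 𝕜] [AddCommGroup E] [Module 𝕜 E]

/-- The space `E`, endowed with the seminorm `p`. -/
def SeminormedBy (_ : Seminorm 𝕜 E) : Type _ := E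

variable (p : Seminorm 𝕜 E)

noncomputable instance : SeminormedAddCommGroup (SeminormedBy p) :=
  p.toAddGroupSeminorm.toSeminormedAddCommGroup

noncomputable instance : NormedSpace 𝕜 (SeminormedBy p) where
  toModule := inferInstanceAs (Module 𝕜 E)
  norm_smul_le a x := (map_smul_eq_mul p a x).le

/-- Even if `p` has a kernel, a functional of operator norm zero vanishes, so no quotient of `E` is
needed. -/
noncomputable instance : NormedAddCommGroup (SeminormedBy p →L[𝕜] 𝕜) :=
  NormedAddCommGroup.ofSeparation fun f hf => by
    ext x
    simpa [hf] using f.le_opNorm x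

variable {p} [TopologicalSpace E] [IsTopologicalAddGroup E]

/-- The identity of `E`, as a continuous map to the space endowed with a continuous seminorm. -/
noncomputable def SeminormedBy.ofL (hp : Continuous p) : E →L[𝕜] SeminormedBy p where
  toLinearMap := { toFun := fun x => x, map_add' := fun _ _ => rfl, map_smul' := fun _ _ => rfl }
  cont := by
    let L : E →+ SeminormedBy p := { toFun := fun x => x, map_zero' := rfl, map_add' := fun _ _ => rfl }
    refine continuous_of_continuousAt_zero L ?_
    rw [ContinuousAt, map_zero, tendsto_zero_iff_norm_tendsto_zero]
    simpa using! hp.tendsto 0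

/-- The inclusion into the dual of `E` of the Banach space of functionals that are bounded with
respect to a continuous seminorm. -/
noncomputable def dualInclusion (hp : Continuous p) :
    (SeminormedBy p →L[𝕜] 𝕜) →L[𝕜] (E →L[𝕜] 𝕜) :=
  ContinuousLinearMap.precomp 𝕜 (SeminormedBy.ofL hp)

lemma norm_le_of_dualInclusion (hp : Continuous p) (g : SeminormedBy p →L[𝕜] 𝕜) {C : ℝ}
    (hC : 0 ≤ C) (h : ∀ x, ‖dualInclusion hp g x‖ ≤ C * p x) : ‖g‖ ≤ C :=
  g.opNorm_le_bound hC h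

lemma dualInclusion_injective (hp : Continuous p) : Function.Injective (dualInclusion hp) :=
  fun _ _ h => ContinuousLinearMap.ext fun x => DFunLike.congr_fun h (x : E)

lemma exists_dualInclusion_eq (hp : Continuous p) (f : E →L[𝕜] 𝕜) {C : ℝ}
    (h : ∀ x, ‖f x‖ ≤ C * p x) : ∃ g, dualInclusion hp g = f := by
  let g₀ : SeminormedBy p →ₗ[𝕜] 𝕜 :=
    { toFun := fun x => f x, map_add' := f.map_add, map_smul' := f.map_smul }
  exact ⟨g₀.mkContinuous C h, rfl⟩

end SeminormedBy

/-- Compact subsets of the strong dual of a barrelled space are dominated by a single seminorm. -/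
lemma StrongDual.exists_forall_norm_le_of_isCompact {𝕜 E : Type*} [RCLike 𝕜] [AddCommGroup E]
    [Module 𝕜 E] [UniformSpace E] [IsUniformAddGroup E] [ContinuousSMul 𝕜 E] [BarrelledSpace 𝕜 E]
    {p : ℕ → Seminorm 𝕜 E} (hcof : ∀ q : Seminorm 𝕜 E, Continuous q → ∃ n, q ≤ p n)
    {K : Set (E →L[𝕜] 𝕜)} (hK : IsCompact K) : ∃ n, ∀ f ∈ K, ∀ x, ‖f x‖ ≤ p n x := by
  have h := (norm_withSeminorms 𝕜 𝕜).banach_steinhaus (𝓕 := fun f : K => f.1) fun _ x => by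
    have : BddAbove ((fun f : E →L[𝕜] 𝕜 => ‖f x‖) '' K) :=
      (hK.image (continuous_norm.comp (continuous_eval_const x))).bddAbove
    rwa [image_eq_range] at this
  obtain ⟨q, hq, hqK⟩ := ((norm_withSeminorms 𝕜 𝕜).uniformEquicontinuous_iff_exists_continuous_seminorm
    (fun f : K => f.1.toLinearMap)).1 h 0
  obtain ⟨n, hn⟩ := hcof q hq
  exact ⟨n, fun f hf x => (hqK ⟨f, hf⟩ x).trans (hn x)⟩

/-! ### Inductive limit and compact regularity -/

section StrongDual

variable {𝕜 E : Type*} [RCLike 𝕜] [AddCommGroup E] [Module 𝕜 E] [Module ℝ E]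
  [IsScalarTower ℝ 𝕜 E] [UniformSpace E] [IsUniformAddGroup E] [ContinuousSMul 𝕜 E]
  [LocallyConvexSpace ℝ E]

/-- A seminorm on the strong dual of a quasinormable metrizable space that is continuous on each
space of functionals bounded with respect to a defining seminorm has a unit ball that is a
neighbourhood of zero. -/
lemma IsQuasinormable.setOf_seminorm_le_one_mem_nhds (hE : IsQuasinormable 𝕜 E)
    {p : ℕ → Seminorm 𝕜 E} (hp : ∀ n, Continuous (p n)) (hmono : Monotone p)
    (hcof : ∀ q : Seminorm 𝕜 E, Continuous q → ∃ n, q ≤ p n) (N : Seminorm 𝕜 (E →L[𝕜] 𝕜))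
    (hN : ∀ k, Continuous fun g => N (dualInclusion (hp k) g)) :
    {f | N f ≤ 1} ∈ 𝓝 (0 : E →L[𝕜] 𝕜) := by
  have hb : ∀ k, ∃ c : NNReal, 0 < c ∧
      ∀ g : SeminormedBy (p k) →L[𝕜] 𝕜, N (dualInclusion (hp k) g) ≤ c * ‖g‖ := fun k => by
    obtain ⟨C, hC, h⟩ := Seminorm.bound_of_continuous_normedSpace
      (N.comp (dualInclusion (hp k)).toLinearMap) (hN k)
    exact ⟨⟨C, hC.le⟩, hC, h⟩
  choose c hc hN using hb
  obtain ⟨D, hD, hDN⟩ := hE.exists_isVonNBounded_seminorm_le_one hp hmono hcof N hc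
    fun k a f hf => by
      obtain ⟨g, rfl⟩ := exists_dualInclusion_eq (hp k) f hf
      have := norm_le_of_dualInclusion (hp k) g a.2 hf
      calc _ ≤ (c k : ℝ) * ‖g‖ := hN k g
        _ ≤ c k * a := by gcongr; exact this
        _ = a * c k := mul_comm _ _
  filter_upwards [ContinuousLinearMap.eventually_nhds_zero_mapsTo (F := 𝕜) (σ := RingHom.id 𝕜) hD
    (Metric.closedBall_mem_nhds (0 : 𝕜) one_pos)] with f hf
  exact hDN f fun x hx => by simpa using hf hx

/-- The strong dual of a quasinormable metrizable space is the inductive limit of the Banach spaces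
of functionals that are bounded with respect to one of the defining seminorms. -/
lemma IsQuasinormable.isLBLimit_dualInclusion (hE : IsQuasinormable 𝕜 E)
    {p : ℕ → Seminorm 𝕜 E} (hp : ∀ n, Continuous (p n)) (hmono : Monotone p)
    (hcof : ∀ q : Seminorm 𝕜 E, Continuous q → ∃ n, q ≤ p n) :
    IsLBLimit 𝕜 (G := fun n => SeminormedBy (p n) →L[𝕜] 𝕜) fun n => (dualInclusion (hp n)).toLinearMap where
  completeSpace _ := inferInstance
  injective n := dualInclusion_injective (hp n)
  inclusion n := by
    let L : SeminormedBy (p (n + 1)) →L[𝕜] SeminormedBy (p n) :=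
      LinearMap.mkContinuous
        { toFun := fun x => x, map_add' := fun _ _ => rfl, map_smul' := fun _ _ => rfl } 1
        fun x => by simpa using! hmono n.le_succ x
    exact ⟨ContinuousLinearMap.precomp 𝕜 L, fun _ => ContinuousLinearMap.ext fun _ => rfl⟩
  exhausts f := by
    obtain ⟨n, hn⟩ := hcof (dualSeminorm f.toLinearMap) (continuous_norm.comp f.continuous)
    exact ⟨n, exists_dualInclusion_eq (hp n) f (C := 1) fun x => by simpa using! hn x⟩
  topology_isLeast := by
    refine ⟨⟨⟨inferInstance, inferInstance, inferInstance⟩,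
      fun n => (dualInclusion (hp n)).continuous⟩, ?_⟩
    rintro t ⟨ht, hc⟩
    exact IsLocallyConvexTopology.le_of_forall_seminorm inferInstance ht fun N hN =>
      hE.setOf_seminorm_le_one_mem_nhds hp hmono hcof N fun k =>
        @Continuous.comp _ _ _ _ t _ _ _ hN (hc k)

/-- In the strong dual of a quasinormable Fréchet space, a compact set is the image of a compact set
of functionals that are bounded with respect to one of the defining seminorms. -/
lemma IsQuasinormable.exists_isCompact_image_dualInclusion [BarrelledSpace 𝕜 E]
    (hE : IsQuasinormable 𝕜 E)
    {p : ℕ → Seminorm 𝕜 E} (hp : ∀ n, Continuous (p n)) (hmono : Monotone p)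
    (hcof : ∀ q : Seminorm 𝕜 E, Continuous q → ∃ n, q ≤ p n)
    {K : Set (E →L[𝕜] 𝕜)} (hK : IsCompact K) :
    ∃ m, ∃ K' : Set (SeminormedBy (p m) →L[𝕜] 𝕜), IsCompact K' ∧ dualInclusion (hp m) '' K' = K := by
  obtain ⟨n, hn⟩ := StrongDual.exists_forall_norm_le_of_isCompact hcof hK
  obtain ⟨m, hnm, hm⟩ := hE.exists_eventually_sub_le hp hmono hcof n
  choose φ hφ using fun f : K => exists_dualInclusion_eq (hp m) f.1 (C := 1)
    (fun x => by simpa using (hn f f.2 x).trans (hmono hnm x))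
  -- On the equicontinuous set `K`, strong convergence implies convergence in the norm of step `m`.
  have hφc : Continuous φ := by
    rw [continuous_iff_continuousAt]
    intro f₀
    rw [ContinuousAt, Metric.tendsto_nhds]
    intro ε hε
    filter_upwards [continuous_subtype_val.continuousAt.eventually
      (hm f₀ (hn f₀ f₀.2) (ε / 2) (half_pos hε))] with f hf
    rw [dist_eq_norm]
    refine (norm_le_of_dualInclusion (hp m) _ (half_pos hε).le fun x => ?_).trans_lt
      (half_lt_self hε)
    rw [map_sub, hφ, hφ]
    exact hf (hn f f.2) x
  have : CompactSpace K := isCompact_iff_compactSpace.1 hK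
  refine ⟨m, range φ, isCompact_range hφc, ?_⟩
  rw [← range_comp]
  simp [Function.comp_def, hφ]

end StrongDual

/-- The strong dual `E →L[𝕜] 𝕜` of a quasinormable Fréchet space `E` is complete, is an LB-space,
and is compactly regular with respect to every sequence of Banach spaces of which it is the
inductive limit. -/
theorem proposition4p1 {𝕜 E : Type*} [RCLike 𝕜] [AddCommGroup E] [Module 𝕜 E]
    [Module ℝ E] [IsScalarTower ℝ 𝕜 E] [UniformSpace E] [IsUniformAddGroup E]
    [ContinuousSMul 𝕜 E] [LocallyConvexSpace ℝ E] [T2Space E] [FirstCountableTopology E]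
    [CompleteSpace E] (hE : IsQuasinormable 𝕜 E) :
    CompleteSpace (E →L[𝕜] 𝕜) ∧ IsLBSpace 𝕜 (E →L[𝕜] 𝕜) ∧
      ∀ (G : ℕ → Type*) [∀ k, NormedAddCommGroup (G k)] [∀ k, NormedSpace 𝕜 (G k)]
        (ι : ∀ k, G k →ₗ[𝕜] (E →L[𝕜] 𝕜)), IsLBLimit 𝕜 ι → IsCompactlyRegular ι := by
  obtain ⟨p, hp, hmono, hcof⟩ := exists_cofinal_seminorm_seq 𝕜 E
  refine ⟨inferInstance, ⟨inferInstance, fun n => SeminormedBy (p n) →L[𝕜] 𝕜, fun _ => inferInstance,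
    fun _ => inferInstance, _, hE.isLBLimit_dualInclusion hp hmono hcof⟩, ?_⟩
  intro G _ _ ι hι K hK
  -- With completeness this makes `E` a Baire space, hence barrelled.
  have : (uniformity E).IsCountablyGenerated := IsUniformAddGroup.uniformity_countably_generated
  have hcomp : ∀ k, CompleteSpace (G k) := hι.completeSpace
  obtain ⟨m, K', hK', rfl⟩ := hE.exists_isCompact_image_dualInclusion hp hmono hcof hK
  obtain ⟨k, v, hv⟩ := (dualInclusion (hp m)).exists_factorization
    (fun k => (⟨ι k, hι.topology_isLeast.1.2 k⟩ : G k →L[𝕜] (E →L[𝕜] 𝕜))) hι.injective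
    fun y => hι.exhausts _
  have himage : dualInclusion (hp m) '' K' = ι k '' (v '' K') := by
    rw [image_image]
    exact image_congr fun y _ => (hv y).symm
  refine ⟨k, ?_, ?_⟩
  · rw [himage]
    exact image_subset_range _ _
  · rw [himage, preimage_image_eq _ (hι.injective k)]
    exact hK'.image v.continuous
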